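/- A Hausdorff pair $(X,X_0)$ is a Hausdorff space $X$ with a subset $X_0\subseteq X$. It is a compact Hausdorff pair if $X$ and $X_0$ are both compact. A map of pairs $(X,X_0)\to(Y,Y_0)$ is a continuous map $X\to Y$ sending $X_0$ into $Y_0$; two such maps are homotopic if they are homotopic through maps of pairs. Let $\mathrm{HCpt}^2$ be the category of compact Hausdorff pairs and homotopy classes of maps of pairs. A direct system $X^*=\{X_a,p_{aa'},A\}$ in a category consists of a directed preordered set $A$, objects $X_a$ ($a\in A$) and morphisms $p_{aa'}:X_a\to X_{a'}$ ($a\le a'$) with $p_{aa}=1$ and $p_{a'a''}p_{aa'}=p_{aa''}$. A morphism $(f_a,f):X^*\to Y^*=\{Y_b,q_{bb'},B\}$ consists of an order-preserving function $f:A\to B$ and morphisms $f_a:X_a\to Y_{f(a)}$ with $q_{f(a)f(a')}f_a=f_{a'}p_{aa'}$ whenever $a\le a'$. Two morphisms $(f_a,f),(g_a,g):X^*\to Y^*$ are equivalent, written $(f_a,f)\simeq(g_a,g)$, if for every $a\in A$ there is $b\in B$ with $f(a),g(a)\le b$ and $q_{f(a)b}f_a=q_{g(a)b}g_a$. For a Hausdorff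 pair $(X,X_0)$ let $C(X,X_0)$ be the direct system in $\mathrm{HCpt}^2$ of all compact subpairs $(K,K_0)$, that is, $K$ and $K_0$ are compact, $K_0\subseteq K\subseteq X$ and $K_0\subseteq X_0$, ordered by inclusion in both components, with the homotopy classes of the inclusions as transition morphisms. Two Hausdorff pairs $(X,X_0)$ and $(Y,Y_0)$ have the same CH-shape, written $\mathrm{Sh}_{\mathrm{CH}}(X,X_0)=\mathrm{Sh}_{\mathrm{CH}}(Y,Y_0)$, if there are morphisms of direct systems $F:C(X,X_0)\to C(Y,Y_0)$ and $G:C(Y,Y_0)\to C(X,X_0)$ with $GF\simeq 1_{C(X,X_0)}$ and $FG\simeq 1_{C(Y,Y_0)}$. **Theorem.** Let $(X,X_0)$ and $(Y,Y_0)$ be Hausdorff pairs with $\mathrm{Sh}_{\mathrm{CH}}(X,X_0)=\mathrm{Sh}_{\mathrm{CH}}(Y,Y_0)$. Then for every abelian group $G$ and every integer $n\ge 0$ the relative singular homology groups are isomorphic: $$H_n(X,X_0;G)\cong H_n(Y,Y_0;G).$$ -/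

import Mathlib

open CategoryTheory Limits TopologicalSpace

universe u v w

/-! ### Direct systems in a category -/

/-- A direct system in a category `C`: a directed preordered index set `A` together with a functor
from `A` to `C`, that is, objects `X_a` and compatible transition morphisms `X_a ⟶ X_{a'}`
for `a ≤ a'`. -/
structure DirSystem (C : Type u) [Category.{v} C] where
  /-- The index set. -/
  A : Type w
  [preorder : Preorder A]
  [directed : IsDirectedOrder A]
  /-- The objects and the transition morphisms. -/
  diagram : A ⥤ C

attribute [instance] DirSystem.preorder DirSystem.directed

namespace DirSystem

variable {C : Type u} [Category.{v} C]

/-- The transition morphism `X_a ⟶ X_{a'}` of a direct system, for `a ≤ a'`. -/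
abbrev trans (S : DirSystem.{u, v, w} C) {a a' : S.A} (h : a ≤ a') :
    S.diagram.obj a ⟶ S.diagram.obj a' :=
  S.diagram.map (homOfLE h)

/-- A morphism of direct systems: an order-preserving function `f` between the index sets and
morphisms `X_a ⟶ Y_{f a}` that commute with the transition morphisms. -/
structure Hom (S T : DirSystem.{u, v, w} C) where
  /-- The function between the index sets. -/
  f : S.A → T.A
  mono : Monotone f
  /-- The components. -/
  app (a : S.A) : S.diagram.obj a ⟶ T.diagram.obj (f a)
  comm {a a' : S.A} (h : a ≤ a') : app a ≫ T.trans (mono h) = S.trans h ≫ app a'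

namespace Hom

/-- The identity morphism of a direct system. -/
def id (S : DirSystem.{u, v, w} C) : Hom S S where
  f a := a
  mono := fun _ _ h => h
  app _ := 𝟙 _
  comm _ := by simp

/-- The composite `X ⟶ Y ⟶ Z` of two morphisms of direct systems (first `F`, then `G`). -/
def comp {S T U : DirSystem.{u, v, w} C} (F : Hom S T) (G : Hom T U) : Hom S U where
  f a := G.f (F.f a)
  mono := fun _ _ h => G.mono (F.mono h)
  app a := F.app a ≫ G.app (F.f a)
  comm h := by
    rw [Category.assoc, G.comm (F.mono h), ← Category.assoc, F.comm h, Category.assoc]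

/-- Two morphisms of direct systems are equivalent if, for every index `a`, their components
at `a` become equal at some index above both `f a` and `g a`. -/
def Equivalent {S T : DirSystem.{u, v, w} C} (F G : Hom S T) : Prop :=
  ∀ a : S.A, ∃ (b : T.A) (hF : F.f a ≤ b) (hG : G.f a ≤ b),
    F.app a ≫ T.trans hF = G.app a ≫ T.trans hG

end Hom

/-- Two direct systems are equivalent if there are morphisms in both directions whose two
composites are equivalent to the identities. -/
def Equivalent (S T : DirSystem.{u, v, w} C) : Prop :=
  ∃ (F : Hom S T) (G : Hom T S),
    (F.comp G).Equivalent (Hom.id S) ∧ (G.comp F).Equivalent (Hom.id T)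

end DirSystem

/-! ### The homotopy category of compact Hausdorff pairs -/

/-- A pair `(X, X₀)` of spaces is a compact Hausdorff pair if `X` is Hausdorff and
both `X` and `X₀` are compact. -/
def TopPair.isCompactHausdorff : ObjectProperty TopPair.{u} := fun P =>
  T2Space P.fst ∧ CompactSpace P.fst ∧ CompactSpace P.snd

/-- The category of compact Hausdorff pairs and continuous maps of pairs. -/
abbrev CptPair : Type (u + 1) :=
  (TopPair.isCompactHausdorff.{u}).FullSubcategory

/-- Homotopy of maps between compact Hausdorff pairs (the image of the subspace stays in the
subspace all along the homotopy). -/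
def CptPair.homotopyRel : HomRel CptPair.{u} := fun _ _ f g =>
  TopPair.Homotopic f.hom g.hom

/-- Homotopy is an equivalence relation compatible with composition, hence two maps become equal
in the quotient category below exactly if they are homotopic. -/
instance CptPair.homotopyRel_congruence : Congruence CptPair.homotopyRel.{u} where
  equivalence :=
    { refl := fun f => TopPair.Homotopic.equivalence.refl f.hom
      symm := fun h => TopPair.Homotopic.equivalence.symm h
      trans := fun h h' => TopPair.Homotopic.equivalence.trans h h' }
  comp_left f _ _ h := h.map fun H => H.comp (TopPair.Homotopy.refl f.hom)
  comp_right g h := h.map fun H => (TopPair.Homotopy.refl g.hom).comp H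

/-- The homotopy category of compact Hausdorff pairs: the objects are compact Hausdorff pairs, the
morphisms are homotopy classes of maps of pairs. -/
abbrev HCptPair : Type (u + 1) :=
  CategoryTheory.Quotient CptPair.homotopyRel.{u}

/-! ### The direct system of compact subpairs of a pair, and CH-shape -/

section Shape

variable {X : Type u} [TopologicalSpace X]

/-- The compact subpairs `(K, K₀)` of `(X, X₀)`: `K` and `K₀` are compact subsets of `X` with
`K₀ ⊆ K` and `K₀ ⊆ X₀`. They are ordered by inclusion in both components. -/
abbrev CompactSubpair (X₀ : Set X) : Type u :=
  {p : Compacts X × Compacts X // p.2 ≤ p.1 ∧ (p.2 : Set X) ⊆ X₀}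

namespace CompactSubpair

variable {X₀ : Set X}

/-- The set `K` of a compact subpair `(K, K₀)`. -/
abbrev big (p : CompactSubpair X₀) : Set X := p.1.1

/-- The set `K₀` of a compact subpair `(K, K₀)`. -/
abbrev small (p : CompactSubpair X₀) : Set X := p.1.2

lemma small_subset_big (p : CompactSubpair X₀) : p.small ⊆ p.big := p.2.1

lemma big_mono {p q : CompactSubpair X₀} (h : p ≤ q) : p.big ⊆ q.big := h.1

lemma small_mono {p q : CompactSubpair X₀} (h : p ≤ q) : p.small ⊆ q.small := h.2

instance : IsDirectedOrder (CompactSubpair X₀) where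
  directed p q :=
    ⟨⟨p.1 ⊔ q.1, sup_le_sup p.2.1 q.2.1, by
        simpa using And.intro p.2.2 q.2.2⟩,
      show p.1 ≤ p.1 ⊔ q.1 from le_sup_left, show q.1 ≤ p.1 ⊔ q.1 from le_sup_right⟩

/-- The topological pair `(K, K₀)` with the subspace topologies. -/
def toTopPair (p : CompactSubpair X₀) : TopPair.{u} :=
  TopPair.of (A := TopCat.of p.small) (X := TopCat.of p.big)
    (TopCat.ofHom ⟨Set.inclusion p.small_subset_big, continuous_inclusion _⟩)
    (Topology.IsEmbedding.inclusion p.small_subset_big)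

/-- The inclusion of compact subpairs, as a map of pairs. -/
def inclusion {p q : CompactSubpair X₀} (h : p ≤ q) : p.toTopPair ⟶ q.toTopPair :=
  TopPair.ofHom (X := p.toTopPair) (Y := q.toTopPair)
    (TopCat.ofHom ⟨Set.inclusion (big_mono h), continuous_inclusion _⟩)
    (TopCat.ofHom ⟨Set.inclusion (small_mono h), continuous_inclusion _⟩)
    rfl

/-- The compact subpairs of a Hausdorff pair and their inclusions, as a functor to compact
Hausdorff pairs. -/
def functor [T2Space X] (X₀ : Set X) : CompactSubpair X₀ ⥤ CptPair.{u} where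
  obj p := ⟨p.toTopPair, inferInstanceAs (T2Space p.big),
    isCompact_iff_compactSpace.mp p.1.1.isCompact, isCompact_iff_compactSpace.mp p.1.2.isCompact⟩
  map h := ObjectProperty.homMk (inclusion (leOfHom h))
  map_id _ := rfl
  map_comp _ _ := rfl

end CompactSubpair

/-- The direct system `C(X, X₀)`, in the homotopy category of compact Hausdorff pairs, associated
with a Hausdorff pair `(X, X₀)`: all compact subpairs with the homotopy classes of the
inclusions. -/
def compactSystem [T2Space X] (X₀ : Set X) : DirSystem.{u + 1, u, u} HCptPair.{u} where
  A := CompactSubpair X₀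
  diagram := CompactSubpair.functor X₀ ⋙ CategoryTheory.Quotient.functor CptPair.homotopyRel.{u}

/-- The Hausdorff pairs `(X, X₀)` and `(Y, Y₀)` have the same compact Hausdorff shape. -/
def SameCHShape {Y : Type u} [TopologicalSpace Y] [T2Space X] [T2Space Y]
    (X₀ : Set X) (Y₀ : Set Y) : Prop :=
  (compactSystem X₀).Equivalent (compactSystem Y₀)

end Shape

/-! ### Relative singular homology -/

/-- The relative singular chain complex of a pair with coefficients in an abelian group `G`: the
cokernel of the map from the singular chains of the subspace to those of the space. -/
noncomputable def relSingularChainComplex (G : AddCommGrpCat.{u}) (P : TopPair.{u}) :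
    ChainComplex AddCommGrpCat.{u} ℕ :=
  cokernel (((AlgebraicTopology.singularChainComplexFunctor AddCommGrpCat.{u}).obj G).map P.map)

/-- The relative singular homology group `H_n(X, X₀; G)` of `X₀ ⊆ X`. -/
noncomputable def relSingularHomology (n : ℕ) (X : Type u) [TopologicalSpace X] (X₀ : Set X)
    (G : Type u) [AddCommGroup G] : AddCommGrpCat.{u} :=
  (relSingularChainComplex (AddCommGrpCat.of G)
    (TopPair.ofSubset (X := TopCat.of X) X₀)).homology n

/-! Singular homology has compact supports. A singular simplex has compact image, so it lies in a
compact subset, and the groups `H_n(K, K₀; G)` of the compact subpairs have colimit `H_n(X, X₀; G)`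
(`CompactSubpair.isColimitRelHomology`). The colimit property passes from simplices to chains, since
chains are coproducts of copies of `G`. It then passes to relative chains, since cokernels commute
with colimits, and to homology, since filtered colimits of abelian groups are exact.

Relative homology is homotopy invariant (`TopPair.Homotopic.relHomology_map_eq`), hence a functor on
the homotopy category of compact pairs. The group `H_n(X, X₀; G)` is thus the colimit of a functor
applied to `C(X, X₀)`, and equivalent direct systems have isomorphic colimits under any functor
(`DirSystem.Equivalent.nonempty_iso`). -/

/-! ### Homology of filtered colimits of complexes. -/

namespace HomologicalComplex

variable {ι : Type*} {c : ComplexShape ι}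

lemma exists_toCycles_eq_of_homologyπ_eq_zero (K : HomologicalComplex AddCommGrpCat.{u} c)
    {k i : ι} (hk : c.prev i = k) (z : K.cycles i) (hz : K.homologyπ i z = 0) :
    ∃ y : K.X k, K.toCycles k i y = z := by
  have hex := (ShortComplex.mk _ _ (K.toCycles_comp_homologyπ k i)).exact_of_g_is_cokernel
    (K.homologyIsCokernel k i hk)
  exact (ShortComplex.ab_exact_iff _).1 hex z hz

lemma homologyπ_toCycles_apply (K : HomologicalComplex AddCommGrpCat.{u} c)
    (k i : ι) (y : K.X k) : K.homologyπ i (K.toCycles k i y) = 0 := by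
  rw [← ConcreteCategory.comp_apply, K.toCycles_comp_homologyπ]; rfl

lemma iCycles_injective (K : HomologicalComplex AddCommGrpCat.{u} c) (i : ι) :
    Function.Injective (K.iCycles i) :=
  (AddCommGrpCat.mono_iff_injective _).1 inferInstance

lemma homologyπ_surjective (K : HomologicalComplex AddCommGrpCat.{u} c) (i : ι) :
    Function.Surjective (K.homologyπ i) :=
  (AddCommGrpCat.epi_iff_surjective _).1 inferInstance

lemma exists_iCycles_eq (K : HomologicalComplex AddCommGrpCat.{u} c) (i : ι) (x : K.X i)
    (hx : K.d i (c.next i) x = 0) : ∃ z : K.cycles i, K.iCycles i z = x :=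
  ⟨(K.sc i).abCyclesIso.inv ⟨x, hx⟩, (K.sc i).abCyclesIso_inv_apply_iCycles ⟨x, hx⟩⟩

lemma iCycles_cyclesMap_apply {K L : HomologicalComplex AddCommGrpCat.{u} c} (φ : K ⟶ L) (i : ι)
    (z : K.cycles i) : L.iCycles i (cyclesMap φ i z) = φ.f i (K.iCycles i z) := by
  rw [← ConcreteCategory.comp_apply, cyclesMap_i]; rfl

lemma homologyMap_homologyπ_apply {K L : HomologicalComplex AddCommGrpCat.{u} c} (φ : K ⟶ L)
    (i : ι) (z : K.cycles i) :
    homologyMap φ i (K.homologyπ i z) = L.homologyπ i (cyclesMap φ i z) := by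
  rw [← ConcreteCategory.comp_apply, homologyπ_naturality]; rfl

lemma iCycles_toCycles_apply (K : HomologicalComplex AddCommGrpCat.{u} c) (k i : ι) (y : K.X k) :
    K.iCycles i (K.toCycles k i y) = K.d k i y := by
  rw [← ConcreteCategory.comp_apply, toCycles_i]

lemma f_d_apply {K L : HomologicalComplex AddCommGrpCat.{u} c} (φ : K ⟶ L) (i j : ι)
    (x : K.X i) : φ.f j (K.d i j x) = L.d i j (φ.f i x) := by
  rw [← ConcreteCategory.comp_apply, ← φ.comm]; rfl

variable {J : Type u} [SmallCategory J]
  {F : J ⥤ HomologicalComplex AddCommGrpCat.{u} c} {s : Cocone F}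

section

variable [IsFiltered J] {i : ι} (hs : IsColimit ((eval AddCommGrpCat.{u} c i).mapCocone s))

include hs in
lemma exists_map_f_eq {j : J} (x y : (F.obj j).X i)
    (h : (s.ι.app j).f i x = (s.ι.app j).f i y) :
    ∃ (k : J) (f : j ⟶ k), (F.map f).f i x = (F.map f).f i y :=
  (IsColimit.eq_iff' hs x y).1 h

include hs in
lemma exists_ι_f_eq (x : s.pt.X i) : ∃ (j : J) (y : (F.obj j).X i), (s.ι.app j).f i y = x :=
  Concrete.isColimit_exists_rep _ hs x

end

lemma map_f_comp_apply {j k l : J} (f : j ⟶ k) (g : k ⟶ l) (i : ι) (x : (F.obj j).X i) :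
    (F.map (f ≫ g)).f i x = (F.map g).f i ((F.map f).f i x) := by
  simp

lemma cocone_f_apply (s : Cocone F) {j k : J} (f : j ⟶ k) (i : ι) (x : (F.obj j).X i) :
    (s.ι.app k).f i ((F.map f).f i x) = (s.ι.app j).f i x := by
  rw [← ConcreteCategory.comp_apply, ← comp_f]
  exact congrArg (fun φ : F.obj j ⟶ s.pt => φ.f i x) (s.w f)

variable [IsFiltered J] (hs : ∀ i, IsColimit ((eval AddCommGrpCat.{u} c i).mapCocone s))

-- A cycle of the colimit lifts to a chain at some stage. The boundary of that chain vanishes in the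
-- colimit, hence at a later stage, where the chain becomes a cycle.
include hs in
lemma exists_homologyMap_ι_eq (i : ι) (x : s.pt.homology i) :
    ∃ (j : J) (y : (F.obj j).homology i), homologyMap (s.ι.app j) i y = x := by
  obtain ⟨z, rfl⟩ := homologyπ_surjective _ _ x
  obtain ⟨j, a, ha⟩ := exists_ι_f_eq (hs i) (s.pt.iCycles i z)
  obtain ⟨k, f, hf⟩ := exists_map_f_eq (hs (c.next i)) ((F.obj j).d i _ a) 0 (by
    rw [f_d_apply, ha, map_zero]
    change (s.pt.iCycles i ≫ s.pt.d i _) z = 0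
    rw [iCycles_d]; rfl)
  obtain ⟨b, hb⟩ := exists_iCycles_eq (F.obj k) i ((F.map f).f i a)
    (by rw [← f_d_apply, hf, map_zero])
  refine ⟨k, (F.obj k).homologyπ i b, ?_⟩
  rw [homologyMap_homologyπ_apply]
  congr 1
  apply iCycles_injective
  rw [iCycles_cyclesMap_apply, hb, cocone_f_apply, ha]
  rfl

-- A chain bounding the image of the cycle already lives at some stage. The bounding relation holds
-- in the colimit, hence at a common later stage.
include hs in
lemma exists_homologyMap_eq_zero (i : ι) {j : J} (x : (F.obj j).homology i)
    (hx : homologyMap (s.ι.app j) i x = 0) :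
    ∃ (k : J) (f : j ⟶ k), homologyMap (F.map f) i x = 0 := by
  obtain ⟨z, rfl⟩ := homologyπ_surjective _ _ x
  rw [homologyMap_homologyπ_apply] at hx
  obtain ⟨y, hy⟩ := exists_toCycles_eq_of_homologyπ_eq_zero _ rfl _ hx
  obtain ⟨k, b, rfl⟩ := exists_ι_f_eq (hs _) y
  obtain ⟨m, f, hf⟩ := exists_map_f_eq (hs i)
    ((F.map (IsFiltered.leftToMax j k)).f i ((F.obj j).iCycles i z))
    ((F.map (IsFiltered.rightToMax j k)).f i ((F.obj k).d _ i b)) (by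
      rw [cocone_f_apply, cocone_f_apply, ← iCycles_cyclesMap_apply, ← hy, iCycles_toCycles_apply,
        f_d_apply]
      rfl)
  refine ⟨m, IsFiltered.leftToMax j k ≫ f, ?_⟩
  rw [homologyMap_homologyπ_apply]
  rw [← map_f_comp_apply, ← map_f_comp_apply, f_d_apply, ← iCycles_cyclesMap_apply,
    ← iCycles_toCycles_apply] at hf
  rw [iCycles_injective _ _ hf, homologyπ_toCycles_apply]

/-- A cocone of complexes of abelian groups over a filtered diagram which is a colimit in each
degree induces a colimit cocone in homology. -/
noncomputable def isColimitHomology (i : ι) :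
    IsColimit ((homologyFunctor AddCommGrpCat.{u} c i).mapCocone s) := by
  -- The forgetful functor preserves filtered colimits and reflects isomorphisms, so the colimit
  -- property may be tested on elements.
  have : ReflectsColimitsOfShape J (CategoryTheory.forget AddCommGrpCat.{u}) :=
    reflectsColimitsOfShape_of_reflectsIsomorphisms
  apply isColimitOfReflects (CategoryTheory.forget AddCommGrpCat.{u})
  apply Types.FilteredColimit.isColimitOf'
  · intro x
    obtain ⟨j, y, h⟩ := exists_homologyMap_ι_eq hs i x
    exact ⟨j, y, h.symm⟩
  · intro j (x : (F.obj j).homology i) (y : (F.obj j).homology i)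
      (h : homologyMap (s.ι.app j) i x = homologyMap (s.ι.app j) i y)
    obtain ⟨k, f, hf⟩ := exists_homologyMap_eq_zero hs i (x - y) (by rw [map_sub, h, sub_self])
    rw [map_sub, sub_eq_zero] at hf
    exact ⟨k, f, hf⟩

end HomologicalComplex

/-! ### Colimits of direct systems and their equivalences. -/

namespace DirSystem

variable {C : Type u} [Category.{v} C] {D : Type*} [Category* D]

namespace Hom

variable {S T U : DirSystem.{u, v, w} C}

/-- The cocone over the image of `S` obtained from a cocone over the image of `T` by precomposition
with a morphism of direct systems. -/
@[simps]
def pullbackCocone (F : Hom S T) (H : C ⥤ D) (c : Cocone (T.diagram ⋙ H)) :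
    Cocone (S.diagram ⋙ H) where
  pt := c.pt
  ι :=
    { app a := H.map (F.app a) ≫ c.ι.app (F.f a)
      naturality a a' h := by
        have := c.w (homOfLE (F.mono (leOfHom h)))
        have hF := F.comm (leOfHom h)
        dsimp at this ⊢
        rw [Category.comp_id, ← this, ← H.map_comp_assoc, ← H.map_comp_assoc, hF]
        rfl }

/-- The morphism between colimits induced by a morphism of direct systems. -/
def colimMap (F : Hom S T) (H : C ⥤ D) {c : Cocone (S.diagram ⋙ H)} (hc : IsColimit c)
    (d : Cocone (T.diagram ⋙ H)) : c.pt ⟶ d.pt :=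
  hc.desc (F.pullbackCocone H d)

lemma ι_colimMap (F : Hom S T) (H : C ⥤ D) {c : Cocone (S.diagram ⋙ H)} (hc : IsColimit c)
    (d : Cocone (T.diagram ⋙ H)) (a : S.A) :
    c.ι.app a ≫ F.colimMap H hc d = H.map (F.app a) ≫ d.ι.app (F.f a) :=
  hc.fac _ _

lemma colimMap_id (H : C ⥤ D) {c : Cocone (S.diagram ⋙ H)} (hc : IsColimit c) :
    (Hom.id S).colimMap H hc c = 𝟙 _ :=
  hc.hom_ext fun a => by
    rw [ι_colimMap, Category.comp_id]
    exact (congrArg (· ≫ c.ι.app a) (H.map_id _)).trans (Category.id_comp _)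

lemma colimMap_comp (F : Hom S T) (G : Hom T U) (H : C ⥤ D) {c : Cocone (S.diagram ⋙ H)}
    (hc : IsColimit c) {d : Cocone (T.diagram ⋙ H)} (hd : IsColimit d)
    (e : Cocone (U.diagram ⋙ H)) :
    (F.comp G).colimMap H hc e = F.colimMap H hc d ≫ G.colimMap H hd e :=
  hc.hom_ext fun a => by
    rw [ι_colimMap, ← Category.assoc, ι_colimMap, Category.assoc, ι_colimMap, ← H.map_comp_assoc]
    rfl

/-- The legs of a cocone absorb transition morphisms, so agreement at a later index is enough. -/
lemma Equivalent.colimMap_eq {F G : Hom S T} (h : F.Equivalent G) (H : C ⥤ D)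
    {c : Cocone (S.diagram ⋙ H)} (hc : IsColimit c) (d : Cocone (T.diagram ⋙ H)) :
    F.colimMap H hc d = G.colimMap H hc d :=
  hc.hom_ext fun a => by
    obtain ⟨b, hF, hG, eq⟩ := h a
    have wF := d.w (homOfLE hF)
    have wG := d.w (homOfLE hG)
    dsimp at wF wG
    rw [ι_colimMap, ι_colimMap, ← wF, ← wG, ← H.map_comp_assoc, ← H.map_comp_assoc, eq]

end Hom

/-- Equivalent direct systems have isomorphic colimits after applying any functor. -/
lemma Equivalent.nonempty_iso {S T : DirSystem.{u, v, w} C} (h : S.Equivalent T) (H : C ⥤ D)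
    {c : Cocone (S.diagram ⋙ H)} (hc : IsColimit c) {d : Cocone (T.diagram ⋙ H)}
    (hd : IsColimit d) : Nonempty (c.pt ≅ d.pt) := by
  obtain ⟨F, G, hFG, hGF⟩ := h
  exact ⟨{
    hom := F.colimMap H hc d
    inv := G.colimMap H hd c
    hom_inv_id := by
      rw [← Hom.colimMap_comp, hFG.colimMap_eq H hc c, Hom.colimMap_id]
    inv_hom_id := by
      rw [← Hom.colimMap_comp, hGF.colimMap_eq H hd d, Hom.colimMap_id] }⟩

end DirSystem

/-! ### Homotopy invariance of relative singular homology. -/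

section HomotopyInvariance

open MonoidalCategory CartesianMonoidalCategory AlgebraicTopology

/-- The functor sending a pair to the inclusion of singular chain complexes. -/
noncomputable def singularChainArrow (G : AddCommGrpCat.{u}) :
    TopPair.{u} ⥤ Arrow (ChainComplex AddCommGrpCat.{u} ℕ) :=
  MorphismProperty.Arrow.forget _ _ _ ⋙
    ((singularChainComplexFunctor AddCommGrpCat.{u}).obj G).mapArrow

/-- The relative singular chain complex as a functor on pairs. -/
noncomputable def relSingularChainFunctor (G : AddCommGrpCat.{u}) :
    TopPair.{u} ⥤ ChainComplex AddCommGrpCat.{u} ℕ :=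
  singularChainArrow G ⋙ coker _

instance (G : AddCommGrpCat.{u}) (P : TopPair.{u}) :
    Mono (((singularChainComplexFunctor AddCommGrpCat.{u}).obj G).map P.map) := by
  have : Mono P.map := (TopCat.mono_iff_injective _).2 P.isEmbedding_map.injective
  infer_instance

/-- The short complex of chain complexes of a pair. -/
noncomputable abbrev relSingularShortComplex (G : AddCommGrpCat.{u}) (P : TopPair.{u}) :
    ShortComplex (ChainComplex AddCommGrpCat.{u} ℕ) :=
  ShortComplex.mk (((singularChainComplexFunctor AddCommGrpCat.{u}).obj G).map P.map)
    (cokernel.π _) (cokernel.condition _)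

/-- The morphism between the short complexes of two pairs induced by a map of pairs. -/
noncomputable abbrev relSingularShortComplexMap (G : AddCommGrpCat.{u}) {P Q : TopPair.{u}}
    (f : P ⟶ Q) : relSingularShortComplex G P ⟶ relSingularShortComplex G Q where
  τ₁ := ((singularChainComplexFunctor AddCommGrpCat.{u}).obj G).map (TopPair.Hom.snd f)
  τ₂ := ((singularChainComplexFunctor AddCommGrpCat.{u}).obj G).map (TopPair.Hom.fst f)
  τ₃ := (relSingularChainFunctor G).map f
  comm₁₂ := by
    dsimp only
    rw [← Functor.map_comp, ← Functor.map_comp, TopPair.Hom.w]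
  comm₂₃ := (coker.π _).naturality ((singularChainArrow G).map f)

lemma relSingularShortComplex_shortExact (G : AddCommGrpCat.{u}) (P : TopPair.{u}) :
    (relSingularShortComplex G P).ShortExact where
  exact := ShortComplex.exact_of_g_is_cokernel _ (cokernelIsCokernel _)
  mono_f := by dsimp; infer_instance
  epi_g := by dsimp; infer_instance

lemma TopCat.Homotopy.quasiIso_singularChain (G : AddCommGrpCat.{u}) {X Y : TopCat.{u}}
    {f : X ⟶ Y} {g : Y ⟶ X} (h₁ : TopCat.Homotopy (f ≫ g) (𝟙 X))
    (h₂ : TopCat.Homotopy (g ≫ f) (𝟙 Y)) :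
    QuasiIso (((singularChainComplexFunctor AddCommGrpCat.{u}).obj G).map f) := by
  let e : HomotopyEquiv (((singularChainComplexFunctor AddCommGrpCat.{u}).obj G).obj X)
      (((singularChainComplexFunctor AddCommGrpCat.{u}).obj G).obj Y) :=
    { hom := ((singularChainComplexFunctor AddCommGrpCat.{u}).obj G).map f
      inv := ((singularChainComplexFunctor AddCommGrpCat.{u}).obj G).map g
      homotopyHomInvId := ((Homotopy.ofEq (Functor.map_comp _ _ _).symm).trans
        (h₁.singularChainComplexFunctorObjMap G)).trans (Homotopy.ofEq (CategoryTheory.Functor.map_id _ _))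
      homotopyInvHomId := ((Homotopy.ofEq (Functor.map_comp _ _ _).symm).trans
        (h₂.singularChainComplexFunctorObjMap G)).trans (Homotopy.ofEq (CategoryTheory.Functor.map_id _ _)) }
  exact e.quasiIso_hom

namespace TopCat

/-- The contraction of the cylinder `X ⊗ I` onto its base. -/
noncomputable def cylinderContraction (X : TopCat.{u}) :
    TopCat.Homotopy (fst X I ≫ ι₀) (𝟙 (X ⊗ I)) where
  -- The height coordinate is multiplied by the time `p.1`, after identifying `I` with the unit
  -- interval.
  toFun p := (show X × I from (p.2.1, I.homeomorph.symm (p.1 * I.homeomorph p.2.2)))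
  continuous_toFun := by
    change Continuous (fun p : unitInterval × (X × I) =>
      (p.2.1, I.homeomorph.symm (p.1 * I.homeomorph p.2.2)))
    fun_prop
  map_zero_left p := Prod.ext rfl (by
    change I.homeomorph.symm (0 * I.homeomorph (p : X × I).2) = 0
    rw [zero_mul]; rfl)
  map_one_left p := Prod.ext rfl (by
    change I.homeomorph.symm (1 * I.homeomorph (p : X × I).2) = (p : X × I).2
    rw [one_mul, Homeomorph.symm_apply_apply])

lemma quasiIso_singularChain_fst (G : AddCommGrpCat.{u}) (X : TopCat.{u}) :
    QuasiIso (((singularChainComplexFunctor AddCommGrpCat.{u}).obj G).map (fst X I)) :=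
  TopCat.Homotopy.quasiIso_singularChain G (g := ι₀) (cylinderContraction X)
    (by rw [ι₀_fst]; exact .refl _)

end TopCat

namespace TopPair

/-- The cylinder `(X × I, A × I)` of a pair `(X, A)`. -/
noncomputable def cylinder (P : TopPair.{u}) : TopPair.{u} :=
  TopPair.of (P.map ▷ TopCat.I) (P.isEmbedding_map.prodMap .id)

/-- The projection of the cylinder of a pair. -/
noncomputable def cylinderProj (P : TopPair.{u}) : P.cylinder ⟶ P :=
  TopPair.ofHom (X := P.cylinder) (SemiCartesianMonoidalCategory.fst P.fst TopCat.I) (SemiCartesianMonoidalCategory.fst P.snd TopCat.I) rfl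

/-- The inclusion of the bottom of the cylinder of a pair. -/
noncomputable def cylinderι₀ (P : TopPair.{u}) : P ⟶ P.cylinder :=
  TopPair.ofHom (Y := P.cylinder) TopCat.ι₀ TopCat.ι₀ rfl

/-- The inclusion of the top of the cylinder of a pair. -/
noncomputable def cylinderι₁ (P : TopPair.{u}) : P ⟶ P.cylinder :=
  TopPair.ofHom (Y := P.cylinder) TopCat.ι₁ TopCat.ι₁ rfl

lemma cylinderι₀_proj (P : TopPair.{u}) : P.cylinderι₀ ≫ P.cylinderProj = 𝟙 P := rfl

lemma cylinderι₁_proj (P : TopPair.{u}) : P.cylinderι₁ ≫ P.cylinderProj = 𝟙 P := rfl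

/-- The projection is a quasi-isomorphism on the chains of the space and of the subspace; the long
exact sequences and the five lemma give the relative case. -/
instance (G : AddCommGrpCat.{u}) (P : TopPair.{u}) :
    QuasiIso ((relSingularChainFunctor G).map P.cylinderProj) :=
  HomologicalComplex.HomologySequence.quasiIso_τ₃
    (relSingularShortComplexMap G P.cylinderProj)
    (relSingularShortComplex_shortExact G _) (relSingularShortComplex_shortExact G _)
    (TopCat.quasiIso_singularChain_fst G _) (TopCat.quasiIso_singularChain_fst G _)

/-- Relative singular homology as a functor on pairs. -/
noncomputable def relHomology (G : AddCommGrpCat.{u}) (n : ℕ) : TopPair.{u} ⥤ AddCommGrpCat.{u} :=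
  relSingularChainFunctor G ⋙ HomologicalComplex.homologyFunctor _ _ n

instance (G : AddCommGrpCat.{u}) (n : ℕ) (P : TopPair.{u}) :
    IsIso ((relHomology G n).map P.cylinderProj) :=
  inferInstanceAs (IsIso (HomologicalComplex.homologyMap _ n))

/-- Both ends are sections of the projection, which is invertible in homology. -/
lemma relHomology_map_cylinderι (G : AddCommGrpCat.{u}) (n : ℕ) (P : TopPair.{u}) :
    (relHomology G n).map P.cylinderι₀ = (relHomology G n).map P.cylinderι₁ := by
  rw [← cancel_mono ((relHomology G n).map P.cylinderProj), ← Functor.map_comp,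
    ← Functor.map_comp, cylinderι₀_proj, cylinderι₁_proj]

lemma Homotopic.relHomology_map_eq {P Q : TopPair.{u}} {f g : P ⟶ Q} (h : Homotopic f g)
    (G : AddCommGrpCat.{u}) (n : ℕ) :
    (relHomology G n).map f = (relHomology G n).map g := by
  obtain ⟨H⟩ := h
  let k : P.cylinder ⟶ Q := TopPair.ofHom (X := P.cylinder) H.fst.h H.snd.h H.w.symm
  have h₀ : P.cylinderι₀ ≫ k = f :=
    MorphismProperty.Arrow.Hom.ext H.snd.ι₀_h H.fst.ι₀_h
  have h₁ : P.cylinderι₁ ≫ k = g :=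
    MorphismProperty.Arrow.Hom.ext H.snd.ι₁_h H.fst.ι₁_h
  rw [← h₀, ← h₁, Functor.map_comp, Functor.map_comp, relHomology_map_cylinderι]

end TopPair

end HomotopyInvariance

/-! ### Singular chains and filtered colimits. -/

section Cocones

open AlgebraicTopology Opposite

variable {J : Type u} [SmallCategory J]

lemma TopCat.exists_factor_of_range_subset {Δ K X : TopCat.{u}} (σ : Δ ⟶ X) (i : K ⟶ X)
    (hi : Topology.IsEmbedding i) (h : Set.range σ ⊆ Set.range i) :
    ∃ τ : Δ ⟶ K, τ ≫ i = σ := by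
  choose τ hτ using fun x => h ⟨x, rfl⟩
  have hσ : i ∘ τ = σ := funext hτ
  exact ⟨TopCat.ofHom ⟨τ, hi.continuous_iff.2 (hσ ▸ σ.hom.continuous)⟩, TopCat.ext hτ⟩

/-- If every compact subset of `s.pt` lies in the image of a member of a filtered cocone of
embeddings, then the singular simplices of `s.pt` are the colimit of those of the diagram. -/
noncomputable def isColimitToSSetObj [IsFiltered J] {F : J ⥤ TopCat.{u}} (s : Cocone F)
    (hemb : ∀ j, Topology.IsEmbedding (s.ι.app j))
    (hcpt : ∀ K : Set s.pt, IsCompact K → ∃ j, K ⊆ Set.range (s.ι.app j))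
    (n : SimplexCategoryᵒᵖ) :
    IsColimit ((TopCat.toSSet ⋙ (evaluation _ _).obj n).mapCocone s) := by
  apply Types.FilteredColimit.isColimitOf'
  · rintro ⟨σ⟩
    have : CompactSpace ↑(unop (SimplexCategory.toTop.{u}.op.obj n)) :=
      inferInstanceAs (CompactSpace (ULift (stdSimplex ℝ _)))
    obtain ⟨j, hj⟩ := hcpt _ (isCompact_range (TopCat.Hom.hom σ).continuous)
    obtain ⟨τ, hτ⟩ := TopCat.exists_factor_of_range_subset σ (s.ι.app j) (hemb j) hj
    exact ⟨j, ⟨τ⟩, congrArg ULift.up hτ.symm⟩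
  · rintro j ⟨σ⟩ ⟨τ⟩ h
    -- The legs are injective, so simplices with the same image already agree at stage `j`.
    refine ⟨j, 𝟙 j, congrArg _ (congrArg ULift.up ?_)⟩
    have : Mono (s.ι.app j) := (TopCat.mono_iff_injective _).2 (hemb j).injective
    exact (cancel_mono (s.ι.app j)).1 (congrArg ULift.down h)

/-- If the singular simplices of `s.pt` are the colimit of those of the diagram, then so are the
singular chains. -/
noncomputable def isColimitSingularChain {F : J ⥤ TopCat.{u}} (s : Cocone F)
    (hs : ∀ n, IsColimit ((TopCat.toSSet ⋙ (evaluation _ _).obj n).mapCocone s))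
    (G : AddCommGrpCat.{u}) :
    IsColimit (((singularChainComplexFunctor AddCommGrpCat.{u}).obj G).mapCocone s) :=
  HomologicalComplex.isColimitOfEval _ _ fun n =>
    -- The chains in degree `n` are the coproduct of copies of `G` over the `n`-simplices, a
    -- colimit-preserving construction.
    isColimitOfPreserves (sigmaConst.obj G) (hs (op (SimplexCategory.mk n)))

/-- The cokernel of a levelwise colimit of arrows is the colimit of the cokernels. -/
noncomputable def isColimitCoker {C : Type*} [Category* C] [HasZeroMorphisms C] [HasCokernels C]
    {F : J ⥤ Arrow C} (s : Cocone F) (h₁ : IsColimit (Arrow.leftFunc.mapCocone s))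
    (h₂ : IsColimit (Arrow.rightFunc.mapCocone s)) : IsColimit ((coker C).mapCocone s) := by
  refine IsColimit.ofExistsUnique fun t => ?_
  obtain ⟨d, hd⟩ : ∃ d : s.pt.right ⟶ t.pt,
      ∀ j, (s.ι.app j).right ≫ d = cokernel.π (F.obj j).hom ≫ t.ι.app j :=
    ⟨h₂.desc ⟨t.pt, Functor.whiskerLeft F (coker.π C) ≫ t.ι⟩, h₂.fac _⟩
  have hw (j : J) : (s.ι.app j).left ≫ s.pt.hom = (F.obj j).hom ≫ (s.ι.app j).right :=
    (s.ι.app j).w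
  -- Vanishing is tested on the left-hand objects of the diagram, where each cokernel projection
  -- kills the arrow.
  have hd₀ : s.pt.hom ≫ d = 0 := h₁.hom_ext fun j => by
    change (s.ι.app j).left ≫ s.pt.hom ≫ d = (s.ι.app j).left ≫ (0 : s.pt.left ⟶ t.pt)
    rw [comp_zero, reassoc_of% (hw j), hd]
    exact (cokernel.condition_assoc _ _).trans zero_comp
  have hπ (j : J) {Z : C} (m : cokernel s.pt.hom ⟶ Z) :
      cokernel.π (F.obj j).hom ≫ ((coker C).mapCocone s).ι.app j ≫ m =
        (s.ι.app j).right ≫ cokernel.π s.pt.hom ≫ m :=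
    (cokernel.π_desc_assoc _ _ _ _).trans (Category.assoc _ _ _)
  refine ⟨cokernel.desc _ d hd₀, fun j => ?_, fun m hm => ?_⟩
  · apply (cancel_epi (cokernel.π (F.obj j).hom)).1
    exact (hπ j _).trans (by rw [cokernel.π_desc, hd])
  · apply (cancel_epi (cokernel.π s.pt.hom)).1
    rw [cokernel.π_desc]
    refine h₂.hom_ext fun j => ?_
    change (s.ι.app j).right ≫ cokernel.π s.pt.hom ≫ m = (s.ι.app j).right ≫ d
    rw [hd, ← hm j]
    exact (hπ j m).symm

/-- Relative singular homology commutes with filtered colimits of pairs for which the singular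
simplices of both members form a colimit. -/
noncomputable def isColimitRelHomology [IsFiltered J] {F : J ⥤ TopPair.{u}} (s : Cocone F)
    (h₁ : ∀ n, IsColimit ((TopCat.toSSet ⋙ (evaluation _ _).obj n).mapCocone
      (TopPair.proj₁.mapCocone s)))
    (h₂ : ∀ n, IsColimit ((TopCat.toSSet ⋙ (evaluation _ _).obj n).mapCocone
      (TopPair.proj₂.mapCocone s)))
    (G : AddCommGrpCat.{u}) (n : ℕ) : IsColimit ((TopPair.relHomology G n).mapCocone s) :=
  have h : IsColimit ((relSingularChainFunctor G).mapCocone s) :=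
    isColimitCoker ((singularChainArrow G).mapCocone s)
      (isColimitSingularChain _ h₂ G) (isColimitSingularChain _ h₁ G)
  HomologicalComplex.isColimitHomology (s := (relSingularChainFunctor G).mapCocone s)
    (fun i => isColimitOfPreserves (HomologicalComplex.eval _ _ i) h) n

end Cocones

/-! ### Compact supports for pairs, and the conclusion. -/

namespace CompactSubpair

variable {X : Type u} [TopologicalSpace X] [T2Space X] (X₀ : Set X)

/-- Together with directedness this makes the index category filtered. -/
instance : Nonempty (CompactSubpair X₀) := ⟨⟨⊥, le_rfl, by simp⟩⟩

/-- The cocone of a pair over its compact subpairs. -/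
def cocone : Cocone (functor X₀ ⋙ ObjectProperty.ι _) where
  pt := TopPair.ofSubset (X := TopCat.of X) X₀
  ι :=
    { app p := TopPair.ofHom (X := p.toTopPair) (Y := TopPair.ofSubset (X := TopCat.of X) X₀)
        (TopCat.ofHom ⟨Subtype.val, continuous_subtype_val⟩)
        (TopCat.ofHom ⟨Set.inclusion p.2.2, continuous_inclusion _⟩) rfl
      naturality _ _ _ := rfl }

/-- The relative singular homology of a Hausdorff pair is the colimit of that of its compact
subpairs. -/
noncomputable def isColimitRelHomology (G : AddCommGrpCat.{u}) (n : ℕ) :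
    IsColimit ((TopPair.relHomology G n).mapCocone (cocone X₀)) := by
  refine _root_.isColimitRelHomology (cocone X₀)
    (isColimitToSSetObj _ (fun p => Topology.IsEmbedding.subtypeVal) ?_)
    (isColimitToSSetObj _ (fun p => Topology.IsEmbedding.inclusion p.2.2) ?_) G n
  -- A compact `K ⊆ X` is covered by `(K, ∅)`; a compact `K ⊆ X₀` must appear in the second
  -- component, and is covered by `(K, K)`.
  · intro (K : Set X) hK
    refine ⟨⟨(⟨K, hK⟩, ⊥), bot_le, by simp⟩, fun x hx => ⟨⟨x, hx⟩, rfl⟩⟩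
  · intro (K : Set X₀) hK
    have hK' : IsCompact (Subtype.val '' K) := hK.image continuous_subtype_val
    exact ⟨⟨(⟨_, hK'⟩, ⟨_, hK'⟩), le_rfl, by simp⟩, fun (x : X₀) hx => ⟨⟨x.1, x, hx, rfl⟩, rfl⟩⟩

end CompactSubpair

/-- Relative singular homology as a functor on the homotopy category of compact Hausdorff pairs. -/
noncomputable def HCptPair.relHomology (G : AddCommGrpCat.{u}) (n : ℕ) :
    HCptPair.{u} ⥤ AddCommGrpCat.{u} :=
  CategoryTheory.Quotient.lift _ (ObjectProperty.ι _ ⋙ TopPair.relHomology G n)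
    fun _ _ _ _ h => TopPair.Homotopic.relHomology_map_eq h G n

/-- The relative homology functor on the homotopy category restricts to the one on pairs. -/
noncomputable def HCptPair.functorCompRelHomology (G : AddCommGrpCat.{u}) (n : ℕ) :
    CategoryTheory.Quotient.functor CptPair.homotopyRel.{u} ⋙ HCptPair.relHomology G n ≅
      ObjectProperty.ι _ ⋙ TopPair.relHomology G n :=
  CategoryTheory.Quotient.lift.isLift _ _ _

/-- The relative homology of the direct system of compact subpairs, computed without passing to
homotopy classes. -/
noncomputable def compactSystemCompRelHomology {X : Type u} [TopologicalSpace X] [T2Space X]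
    (X₀ : Set X) (G : AddCommGrpCat.{u}) (n : ℕ) :
    (compactSystem X₀).diagram ⋙ HCptPair.relHomology G n ≅
      (CompactSubpair.functor X₀ ⋙ ObjectProperty.ι _) ⋙ TopPair.relHomology G n :=
  Functor.associator (CompactSubpair.functor X₀) (CategoryTheory.Quotient.functor _)
      (HCptPair.relHomology G n) ≪≫
    Functor.isoWhiskerLeft (CompactSubpair.functor X₀) (HCptPair.functorCompRelHomology G n) ≪≫
    (Functor.associator _ _ _).symm

/-- The cocone of relative singular homology groups of a Hausdorff pair over the direct system of
its compact subpairs. -/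
noncomputable def compactSystemHomologyCocone {X : Type u} [TopologicalSpace X] [T2Space X]
    (X₀ : Set X) (G : AddCommGrpCat.{u}) (n : ℕ) :
    Cocone ((compactSystem X₀).diagram ⋙ HCptPair.relHomology G n) :=
  (Cocone.precompose (compactSystemCompRelHomology X₀ G n).hom).obj
    ((TopPair.relHomology G n).mapCocone (CompactSubpair.cocone X₀))

/-- The relative singular homology of a Hausdorff pair is the colimit of that of the direct system
of its compact subpairs. -/
noncomputable def isColimitCompactSystemHomologyCocone {X : Type u} [TopologicalSpace X]
    [T2Space X] (X₀ : Set X) (G : AddCommGrpCat.{u}) (n : ℕ) :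
    IsColimit (compactSystemHomologyCocone X₀ G n) :=
  (IsColimit.precomposeHomEquiv _ _).symm (CompactSubpair.isColimitRelHomology X₀ G n)

theorem mainTheorem4 {X Y : Type u} [TopologicalSpace X] [T2Space X]
    [TopologicalSpace Y] [T2Space Y] (X₀ : Set X) (Y₀ : Set Y)
    (h : SameCHShape X₀ Y₀) (G : Type u) [AddCommGroup G] (n : ℕ) :
    Nonempty (relSingularHomology n X X₀ G ≅ relSingularHomology n Y Y₀ G) :=
  h.nonempty_iso (HCptPair.relHomology (AddCommGrpCat.of G) n)
    (isColimitCompactSystemHomologyCocone X₀ _ n) (isColimitCompactSystemHomologyCocone Y₀ _ n)
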